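/- Let $K>d\ge 0$ be integers and let $\Phi\in\mathbb R^{K\times d}$ be a feature matrix of rank $d$ with rows $\phi_1^\top,\dots,\phi_K^\top$. For $k\in[K]$ let $$\mathcal R_k=\{\mu\in\mathbb R^K:\mu_k>\mu_i\ \forall i\ne k\},\qquad \Theta_k=\{\theta\in\mathbb R^d:\Phi\theta\in\mathcal R_k\},$$ and let $\mathcal C_k$ (the robust observation region) be the set of $\mu\in\mathcal R_k$ such that for every probability vector $\alpha$ on $[K]$ for which $\Phi^\top\mathrm{diag}(\alpha)\Phi$ is invertible, the weighted least-squares estimate $\arg\min_{\theta}\sum_{i=1}^K\alpha_i(\phi_i^\top\theta-\mu_i)^2$ lies in $\Theta_k$. A vector $\mu$ is an interior point of $\mathcal C_k$ if for some $\delta>0$ the cell $\prod_{i=1}^K(\mu_i-\delta,\mu_i+\delta)$ is contained in $\mathcal C_k$. Consider a $K$-armed bandit with reward laws $\nu_1,\dots,\nu_K$ on $\mathbb R$, with means $\mu_1,\dots,\mu_K$, that are $\tfrac12$-sub-Gaussian: $\int e^{s(y-\mu_i)}\,d\nu_i(y)\le e^{s^2/8}$ for all $s\in\mathbb R$ and all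 $i$. Given the past and the arm $A_t=i$ played in round $t$, the reward $Y_t$ has law $\nu_i$. The $\varepsilon$-greedy algorithm with $\varepsilon_t=1/\sqrt t$ computes, in round $t$, a least-squares estimate $\hat\theta_t\in\arg\min_\theta\sum_{s<t}(\phi_{A_s}^\top\theta-Y_s)^2$ and, conditionally on the past, plays an arm in $\arg\max_{i}\phi_i^\top\hat\theta_t$ with probability $1-\varepsilon_t$ and a uniformly random arm with probability $\varepsilon_t$; minimizers and maximizers that are not unique may be chosen arbitrarily on the basis of the past. The algorithm may be preceded by $n_0\ge0$ initial rounds (counted in $t$) with arbitrary play, for instance to sample $d$ linearly independent features; $n_0=0$ means no initial phase. If $\mu$ is an interior point of $\mathcal C_k$, then the expected regret is $O(\Delta_{\max}\sqrt T)$, where $\Delta_{\max}=\max_{i\in[K]}(\mu_k-\mu_i)$. More precisely, for all $K$, $n_0$ and $\delta>0$ there is a constant $C=C(K,n_0,\delta)$ such that, whenever $\prod_{i=1}^K(\mu_i-\delta,\mu_i+\delta)\subseteq\mathcal C_k$, $$\mathbb E\Big[\sum_{t=1}^T(\mu_k-\mu_{A_t})\Big]\le C\,\Delta_{\max}\sqrt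 T\qquad\text{for all } T\ge 0 .$$ -/

import Mathlib

open MeasureTheory ProbabilityTheory
open scoped Matrix NNReal

/-- The greedy region `R_k`: reward vectors for which arm `k` is the unique best arm. -/
def greedyRegion {K : ℕ} (k : Fin K) : Set (Fin K → ℝ) :=
  {μ | ∀ i, i ≠ k → μ i < μ k}

/-- `θ ∈ argmin_θ ‖Φ θ - μ‖²`, where the squared norm has weight `α i` in coordinate `i`
(the rows of `Φ` are the feature vectors of the arms). -/
def IsModelEstimate {K d : ℕ} (Φ : Matrix (Fin K) (Fin d) ℝ) (α μ : Fin K → ℝ)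
    (θ : Fin d → ℝ) : Prop :=
  ∀ θ' : Fin d → ℝ,
    ∑ i, α i * ((Φ *ᵥ θ) i - μ i) ^ 2 ≤ ∑ i, α i * ((Φ *ᵥ θ') i - μ i) ^ 2

/-- The robust parameter region `Θ_k`. -/
def robustParameterRegion {K d : ℕ} (Φ : Matrix (Fin K) (Fin d) ℝ) (k : Fin K) :
    Set (Fin d → ℝ) :=
  {θ | Φ *ᵥ θ ∈ greedyRegion k}

/-- The robust observation region `C_k`: arm `k` is optimal for `μ`, and for every sampling
distribution `α` with `Φᵀ diag(α) Φ` invertible the (then unique) model estimate of `μ` lies in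
`Θ_k`. -/
def robustObservationRegion {K d : ℕ} (Φ : Matrix (Fin K) (Fin d) ℝ) (k : Fin K) :
    Set (Fin K → ℝ) :=
  {μ | μ ∈ greedyRegion k ∧
    ∀ α ∈ stdSimplex ℝ (Fin K), IsUnit (Φᵀ * Matrix.diagonal α * Φ) →
      ∀ θ, IsModelEstimate Φ α μ θ → θ ∈ robustParameterRegion Φ k}

/-- The open `K`-dimensional cell of size `δ` centred at `μ`. A vector `μ` is an interior point of
a set `S` when `cell μ δ ⊆ S` for some `δ > 0`. -/
def cell {K : ℕ} (μ : Fin K → ℝ) (δ : ℝ) : Set (Fin K → ℝ) :=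
  {ξ | ∀ i, ξ i ∈ Set.Ioo (μ i - δ) (μ i + δ)}

/-- The largest sub-optimality gap `max_i (μ_k - μ_i)`. -/
noncomputable def maxGap {K : ℕ} (μ : Fin K → ℝ) (k : Fin K) : ℝ :=
  Finset.univ.sup' ⟨k, Finset.mem_univ k⟩ (fun i => μ k - μ i)

/-- The `K`-armed bandit with reward distributions `ν i` has mean vector `μ` and `σ`-sub-Gaussian
rewards: `∫ exp (s (y - μ i)) dν i ≤ exp (σ² s² / 2)` for all real `s`. -/
structure IsSubgaussianBandit {K : ℕ} (ν : Fin K → Measure ℝ) (μ : Fin K → ℝ) (σ : ℝ≥0) :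
    Prop where
  isProbabilityMeasure : ∀ i, IsProbabilityMeasure (ν i)
  mean_eq : ∀ i, ∫ y, y ∂(ν i) = μ i
  subgaussian : ∀ i, HasSubgaussianMGF (fun y => y - μ i) (σ ^ 2) (ν i)

/-- `A t` and `Y t` are the arm and the reward of round `t = 1, 2, …` when the bandit with reward
distributions `ν` is played by some policy; `ℱ t` is the information available after round `t`.
Conditionally on `ℱ t` and on `A (t + 1) = i`, the reward `Y (t + 1)` has law `ν i`. -/
structure IsBanditInteraction {K : ℕ} {Ω : Type*} {mΩ : MeasurableSpace Ω} (P : Measure Ω)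
    (ν : Fin K → Measure ℝ) (ℱ : Filtration ℕ mΩ) (A : ℕ → Ω → Fin K) (Y : ℕ → Ω → ℝ) :
    Prop where
  measurable_arm : ∀ t, Measurable[ℱ (t + 1)] (A (t + 1))
  measurable_reward : ∀ t, Measurable[ℱ (t + 1)] (Y (t + 1))
  reward_law : ∀ (t : ℕ) (S : Set Ω), MeasurableSet[ℱ t] S → ∀ (i : Fin K) (B : Set ℝ),
    MeasurableSet B →
      P (S ∩ A (t + 1) ⁻¹' {i} ∩ Y (t + 1) ⁻¹' B) = P (S ∩ A (t + 1) ⁻¹' {i}) * ν i B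

/-- From round `n₀ + 1` on, the arms `A` are played by the `ε`-greedy algorithm with least-squares
estimates. In round `t + 1`, `θ (t + 1)` is a minimizer of `∑_{s ≤ t} (φ_{A_s}ᵀ θ - Y_s)²`,
`G (t + 1)` is an arm maximizing `φ_iᵀ θ (t + 1)`, and, conditionally on the past `ℱ t`, the
algorithm plays `G (t + 1)` with probability `1 - ε (t + 1)` and a uniformly random arm with
probability `ε (t + 1)`. Any choice among several minimizers or maximizers is allowed.
The first `n₀` rounds are unrestricted (`n₀ = 0`: no initial phase). -/
structure IsEpsGreedy {K d : ℕ} {Ω : Type*} {mΩ : MeasurableSpace Ω} (P : Measure Ω)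
    (Φ : Matrix (Fin K) (Fin d) ℝ) (ε : ℕ → ℝ) (n₀ : ℕ) (ℱ : Filtration ℕ mΩ)
    (A : ℕ → Ω → Fin K) (Y : ℕ → Ω → ℝ) (θ : ℕ → Ω → Fin d → ℝ) (G : ℕ → Ω → Fin K) :
    Prop where
  leastSquares : ∀ t, n₀ ≤ t → ∀ ω, ∀ θ' : Fin d → ℝ,
    ∑ s ∈ Finset.Icc 1 t, ((Φ *ᵥ θ (t + 1) ω) (A s ω) - Y s ω) ^ 2
      ≤ ∑ s ∈ Finset.Icc 1 t, ((Φ *ᵥ θ') (A s ω) - Y s ω) ^ 2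
  greedy : ∀ t, n₀ ≤ t → ∀ ω, ∀ i,
    (Φ *ᵥ θ (t + 1) ω) i ≤ (Φ *ᵥ θ (t + 1) ω) (G (t + 1) ω)
  measurable_greedy : ∀ t, n₀ ≤ t → Measurable[ℱ t] (G (t + 1))
  arm_law : ∀ t, n₀ ≤ t → ∀ S : Set Ω, MeasurableSet[ℱ t] S → ∀ i : Fin K,
    P.real (S ∩ A (t + 1) ⁻¹' {i}) =
      (1 - ε (t + 1)) * P.real (S ∩ G (t + 1) ⁻¹' {i}) + ε (t + 1) * (P.real S / K)

/-- The expected regret `E ∑_{t=1}^T (μ_k - μ_{A_t})` of the plays `A`, `k` being the best arm. -/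
noncomputable def expectedRegret {K : ℕ} {Ω : Type*} {mΩ : MeasurableSpace Ω} (P : Measure Ω)
    (μ : Fin K → ℝ) (k : Fin K) (A : ℕ → Ω → Fin K) (T : ℕ) : ℝ :=
  ∫ ω, ∑ t ∈ Finset.Icc 1 T, (μ k - μ (A t ω)) ∂P

/-!
If the empirical mean of every arm is within `δ` of its true mean, then the least-squares estimate
is the weighted model estimate, with the play counts as weights, of a vector in the cell around `μ`,
so the greedy arm is `k`. Whatever the past, a round plays arm `i` with probability at least
`ε / K`, and a play of arm `i` multiplies its exponential Chernoff weight by a factor of mean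
`q < 1`. Hence each round contracts the expected weight by `exp (-(1 - q) * ε / K)`, without any
control on the random number of plays, and the greedy arm of round `t + 1` is wrong with probability
`O(exp (-κ * ∑ s ≤ t, ε s))`. For `ε t = 1 / √t` this is `O(1 / √t)`, as is the probability of
exploring, and the sum over `t ≤ T` is `O(√T)`.
-/

open scoped ENNReal

section LeastSquares

variable {m n : Type*} [Fintype n]

theorem mulVec_injective_of_rank_eq_card [Finite m] {R : Type*} [Field R] {Φ : Matrix m n R}
    (hΦ : Φ.rank = Fintype.card n) : Function.Injective Φ.mulVec := by
  rw [Matrix.mulVec_injective_iff, linearIndependent_iff_card_eq_finrank_span, Set.finrank,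
    ← Matrix.rank_eq_finrank_span_cols, hΦ]

theorem isUnit_transpose_mul_diagonal_mul [Fintype m] [DecidableEq m] [DecidableEq n]
    {Φ : Matrix m n ℝ} (hΦ : Φ.rank = Fintype.card n) {α : m → ℝ} (hα : ∀ i, 0 < α i) :
    IsUnit (Φᵀ * Matrix.diagonal α * Φ) := by
  have hpos := (Matrix.PosDef.diagonal hα).conjTranspose_mul_mul_same
    (mulVec_injective_of_rank_eq_card hΦ)
  simpa only [Matrix.conjTranspose_eq_transpose_of_trivial] using hpos.isUnit

variable {ι κ : Type*} [DecidableEq κ]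

/-- The mean of the observations `y s`, `s ∈ I`, whose label `a s` is `i`; it is `0` when there are
none. -/
noncomputable def empiricalMean (I : Finset ι) (a : ι → κ) (y : ι → ℝ) (i : κ) : ℝ :=
  (∑ s ∈ I with a s = i, y s) / (I.filter (a · = i)).card

theorem card_mul_empiricalMean (I : Finset ι) (a : ι → κ) (y : ι → ℝ) (i : κ) :
    (I.filter (a · = i)).card * empiricalMean I a y i = ∑ s ∈ I with a s = i, y s := by
  rcases (I.filter (a · = i)).eq_empty_or_nonempty with h | h
  · simp only [h, Finset.card_empty, Nat.cast_zero, zero_mul, Finset.sum_empty]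
  · exact mul_div_cancel₀ _ (Nat.cast_ne_zero.mpr h.card_ne_zero)

theorem sum_filter_sub_sq_eq (I : Finset ι) (a : ι → κ) (y : ι → ℝ) (i : κ) (x : ℝ) :
    ∑ s ∈ I with a s = i, (x - y s) ^ 2 =
      (I.filter (a · = i)).card * (x - empiricalMean I a y i) ^ 2 +
        ∑ s ∈ I with a s = i, (y s - empiricalMean I a y i) ^ 2 := by
  have hmean := card_mul_empiricalMean I a y i
  set b := empiricalMean I a y i
  have expand (s : ι) : (x - y s) ^ 2 =
      (x - b) ^ 2 + (y s - b) ^ 2 + 2 * (x - b) * b - 2 * (x - b) * y s := by ring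
  simp_rw [expand, Finset.sum_sub_distrib, Finset.sum_add_distrib, ← Finset.mul_sum, ← hmean,
    Finset.sum_const, nsmul_eq_mul]
  ring

theorem sum_residual_sq_eq [Fintype κ] (I : Finset ι) (a : ι → κ) (y : ι → ℝ) (v : κ → ℝ) :
    ∑ s ∈ I, (v (a s) - y s) ^ 2 =
      ∑ i, (I.filter (a · = i)).card * (v i - empiricalMean I a y i) ^ 2 +
        ∑ i, ∑ s ∈ I with a s = i, (y s - empiricalMean I a y i) ^ 2 := by
  rw [← Finset.sum_add_distrib, ← Finset.sum_fiberwise I a]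
  refine Finset.sum_congr rfl fun i _ => ?_
  rw [← sum_filter_sub_sq_eq]
  exact Finset.sum_congr rfl fun s hs => by rw [(Finset.mem_filter.mp hs).2]

theorem abs_sum_filter_sub_eq (I : Finset ι) (a : ι → κ) (y : ι → ℝ) (i : κ) (x : ℝ) :
    |∑ s ∈ I with a s = i, (y s - x)| =
      |empiricalMean I a y i - x| * (I.filter (a · = i)).card := by
  rw [Finset.sum_sub_distrib, ← card_mul_empiricalMean, Finset.sum_const, nsmul_eq_mul, ← mul_sub,
    abs_mul, Nat.abs_cast, mul_comm]

end LeastSquares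

section RobustRegion

variable {K d : ℕ} {Φ : Matrix (Fin K) (Fin d) ℝ} {k : Fin K} {μ : Fin K → ℝ} {θ : Fin d → ℝ}

theorem IsModelEstimate.div_const {α : Fin K → ℝ} (h : IsModelEstimate Φ α μ θ) {c : ℝ}
    (hc : 0 ≤ c) : IsModelEstimate Φ (fun i => α i / c) μ θ := fun θ' => by
  simp only [div_mul_eq_mul_div, ← Finset.sum_div]
  exact div_le_div_of_nonneg_right (h θ') hc

theorem mem_robustParameterRegion_of_isModelEstimate (hΦ : Φ.rank = d)
    (hμ : μ ∈ robustObservationRegion Φ k) {α : Fin K → ℝ} (hα : ∀ i, 0 < α i)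
    (hθ : IsModelEstimate Φ α μ θ) : θ ∈ robustParameterRegion Φ k := by
  have hsum : 0 < ∑ i, α i := Finset.sum_pos (fun i _ => hα i) ⟨k, Finset.mem_univ k⟩
  have hpos (i : Fin K) : 0 < α i / ∑ j, α j := div_pos (hα i) hsum
  refine hμ.2 _ ⟨fun i => (hpos i).le, ?_⟩
    (isUnit_transpose_mul_diagonal_mul (hΦ.trans (Fintype.card_fin d).symm) hpos) θ
    (hθ.div_const hsum.le)
  rw [← Finset.sum_div, div_self hsum.ne']

variable {ι : Type*} {I : Finset ι} {a : ι → Fin K} {y : ι → ℝ}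

theorem isModelEstimate_empiricalMean
    (hθ : ∀ θ' : Fin d → ℝ, ∑ s ∈ I, ((Φ *ᵥ θ) (a s) - y s) ^ 2
      ≤ ∑ s ∈ I, ((Φ *ᵥ θ') (a s) - y s) ^ 2) :
    IsModelEstimate Φ (fun i => (I.filter (a · = i)).card) (empiricalMean I a y) θ := fun θ' => by
  have h := hθ θ'
  rw [sum_residual_sq_eq, sum_residual_sq_eq] at h
  exact le_of_add_le_add_right h

theorem mem_robustParameterRegion_of_leastSquares (hΦ : Φ.rank = d) {δ : ℝ}
    (hμ : cell μ δ ⊆ robustObservationRegion Φ k)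
    (hθ : ∀ θ' : Fin d → ℝ, ∑ s ∈ I, ((Φ *ᵥ θ) (a s) - y s) ^ 2
      ≤ ∑ s ∈ I, ((Φ *ᵥ θ') (a s) - y s) ^ 2)
    (hdev : ∀ i, |∑ s ∈ I with a s = i, (y s - μ i)| < δ * (I.filter (a · = i)).card) :
    θ ∈ robustParameterRegion Φ k := by
  have hcard (i : Fin K) : (0 : ℝ) < (I.filter (a · = i)).card := by
    refine (Nat.cast_nonneg _).lt_of_ne fun h => ?_
    have := (abs_nonneg _).trans_lt (hdev i)
    simp only [← h, mul_zero, lt_self_iff_false] at this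
  have hmean : empiricalMean I a y ∈ cell μ δ := fun i => by
    have h := hdev i
    rw [abs_sum_filter_sub_eq] at h
    have ⟨hlower, hupper⟩ := abs_lt.mp (lt_of_mul_lt_mul_right h (hcard i).le)
    constructor <;> linarith
  exact mem_robustParameterRegion_of_isModelEstimate hΦ (hμ hmean) hcard
    (isModelEstimate_empiricalMean hθ)

end RobustRegion

theorem lintegral_mono_of_forall_measurableSet_le {Ω : Type*} {m mΩ : MeasurableSpace Ω}
    (hm : m ≤ mΩ) {P Q : Measure Ω} (hPQ : ∀ S, MeasurableSet[m] S → P S ≤ Q S) {W : Ω → ℝ≥0∞}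
    (hW : Measurable[m] W) : ∫⁻ ω, W ω ∂P ≤ ∫⁻ ω, W ω ∂Q := by
  rw [← lintegral_trim hm hW, ← lintegral_trim hm hW]
  refine lintegral_mono' (@Measure.le_intro _ m _ _ fun S hS _ => ?_) le_rfl
  rw [trim_measurableSet_eq hm hS, trim_measurableSet_eq hm hS]
  exact hPQ S hS

theorem mul_add_le_ofReal_exp_neg_mul {a b c : ℝ≥0∞} {p η : ℝ} (hab : a + b ≠ ∞) (hη : 0 ≤ η)
    (hη' : η ≤ 1) (hp : 0 ≤ p) (ha : ENNReal.ofReal p * (a + b) ≤ a)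
    (hc : c ≤ ENNReal.ofReal (1 - η)) :
    c * a + b ≤ ENNReal.ofReal (Real.exp (-(η * p))) * (a + b) := by
  have hdrop : c * a + b + ENNReal.ofReal (η * p) * (a + b) ≤ a + b := calc
    _ ≤ ENNReal.ofReal (1 - η) * a + b + ENNReal.ofReal η * a := by
      rw [ENNReal.ofReal_mul hη, mul_assoc]
      gcongr
    _ = a + b := by
      rw [add_right_comm, ← add_mul, ← ENNReal.ofReal_add (sub_nonneg.mpr hη') hη, sub_add_cancel,
        ENNReal.ofReal_one, one_mul]
  calc c * a + b
      ≤ a + b - ENNReal.ofReal (η * p) * (a + b) :=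
        ENNReal.le_sub_of_add_le_right (ENNReal.mul_ne_top ENNReal.ofReal_ne_top hab) hdrop
    _ = ENNReal.ofReal (1 - η * p) * (a + b) := by
        rw [ENNReal.ofReal_sub _ (mul_nonneg hη hp), ENNReal.ofReal_one,
          ENNReal.sub_mul fun _ _ => hab, one_mul]
    _ ≤ ENNReal.ofReal (Real.exp (-(η * p))) * (a + b) := by
        gcongr
        exact Real.one_sub_le_exp_neg _

theorem lintegral_exp_le_of_hasSubgaussianMGF {E : Type*} {mE : MeasurableSpace E}
    {ν : Measure E} {f : E → ℝ} {c : ℝ≥0} (hf : HasSubgaussianMGF f c ν) (l b : ℝ) :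
    ∫⁻ y, ENNReal.ofReal (Real.exp (l * f y - b)) ∂ν ≤
      ENNReal.ofReal (Real.exp (c * l ^ 2 / 2 - b)) := by
  simp_rw [Real.exp_sub, div_eq_mul_inv (Real.exp _)]
  rw [← ofReal_integral_eq_lintegral_ofReal ((hf.integrable_exp_mul l).mul_const _)
    (Filter.Eventually.of_forall fun y => by positivity), integral_mul_const]
  gcongr
  exact hf.mgf_le l

section Interaction

variable {K : ℕ} {Ω : Type*} {mΩ : MeasurableSpace Ω} {P : Measure Ω} {ν : Fin K → Measure ℝ}
  {ℱ : Filtration ℕ mΩ} {A : ℕ → Ω → Fin K} {Y : ℕ → Ω → ℝ}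

theorem IsBanditInteraction.measurableSet_arm (hA : IsBanditInteraction P ν ℱ A Y) (t : ℕ)
    (i : Fin K) : MeasurableSet (A (t + 1) ⁻¹' {i}) :=
  ℱ.le (t + 1) _ (hA.measurable_arm t (measurableSet_singleton i))

theorem IsBanditInteraction.map_reward_restrict (hA : IsBanditInteraction P ν ℱ A Y) (t : ℕ)
    (i : Fin K) {S : Set Ω} (hS : MeasurableSet[ℱ t] S) :
    (P.restrict (S ∩ A (t + 1) ⁻¹' {i})).map (Y (t + 1)) =
      P (S ∩ A (t + 1) ⁻¹' {i}) • ν i := by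
  have hY : Measurable (Y (t + 1)) := (hA.measurable_reward t).mono (ℱ.le _) le_rfl
  ext B hB
  rw [Measure.map_apply hY hB, Measure.restrict_apply (hY hB), Set.inter_comm,
    hA.reward_law t S hS i B hB, Measure.smul_apply, smul_eq_mul]

theorem IsBanditInteraction.setLIntegral_mul_reward (hA : IsBanditInteraction P ν ℱ A Y) (t : ℕ)
    (i : Fin K) {W : Ω → ℝ≥0∞} (hW : Measurable[ℱ t] W) {g : ℝ → ℝ≥0∞} (hg : Measurable g) :
    ∫⁻ ω in A (t + 1) ⁻¹' {i}, W ω * g (Y (t + 1) ω) ∂P =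
      (∫⁻ y, g y ∂(ν i)) * ∫⁻ ω in A (t + 1) ⁻¹' {i}, W ω ∂P := by
  have hY : Measurable (Y (t + 1)) := (hA.measurable_reward t).mono (ℱ.le _) le_rfl
  set Q := P.restrict (A (t + 1) ⁻¹' {i})
  have hset (S : Set Ω) (hS : MeasurableSet[ℱ t] S) :
      Q.withDensity (fun ω => g (Y (t + 1) ω)) S = ((∫⁻ y, g y ∂(ν i)) • Q) S := by
    have hS' : MeasurableSet S := ℱ.le t _ hS
    rw [withDensity_apply _ hS', Measure.restrict_restrict hS', ← lintegral_map hg hY,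
      hA.map_reward_restrict t i hS, lintegral_smul_measure, Measure.smul_apply,
      Measure.restrict_apply hS', smul_eq_mul, smul_eq_mul, mul_comm]
  calc ∫⁻ ω, W ω * g (Y (t + 1) ω) ∂Q
      = ∫⁻ ω, W ω ∂(Q.withDensity fun ω => g (Y (t + 1) ω)) := by
        simp_rw [mul_comm (W _)]
        exact (lintegral_withDensity_eq_lintegral_mul Q (hg.comp hY)
          (hW.mono (ℱ.le t) le_rfl)).symm
    _ = ∫⁻ ω, W ω ∂((∫⁻ y, g y ∂(ν i)) • Q) :=
        le_antisymm
          (lintegral_mono_of_forall_measurableSet_le (ℱ.le t) (fun S hS => (hset S hS).le) hW)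
          (lintegral_mono_of_forall_measurableSet_le (ℱ.le t) (fun S hS => (hset S hS).ge) hW)
    _ = (∫⁻ y, g y ∂(ν i)) * ∫⁻ ω, W ω ∂Q := by rw [lintegral_smul_measure, smul_eq_mul]

/-- The product of `g (Y s)` over the rounds `s ≤ t` in which arm `i` is played. For `g` the
exponential of an affine function this is the variable to which the Chernoff bound is applied. -/
noncomputable def armWeight (A : ℕ → Ω → Fin K) (Y : ℕ → Ω → ℝ) (i : Fin K) (g : ℝ → ℝ≥0∞) (t : ℕ)
    (ω : Ω) : ℝ≥0∞ :=
  ∏ s ∈ Finset.Icc 1 t with A s ω = i, g (Y s ω)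

theorem armWeight_succ (A : ℕ → Ω → Fin K) (Y : ℕ → Ω → ℝ) (i : Fin K) (g : ℝ → ℝ≥0∞) (t : ℕ)
    (ω : Ω) : armWeight A Y i g (t + 1) ω =
      armWeight A Y i g t ω * if A (t + 1) ω = i then g (Y (t + 1) ω) else 1 := by
  simp only [armWeight, Finset.prod_filter, Finset.prod_Icc_succ_top (Nat.le_add_left 1 t)]

theorem armWeight_ofReal_exp (A : ℕ → Ω → Fin K) (Y : ℕ → Ω → ℝ) (i : Fin K) (f : ℝ → ℝ)
    (t : ℕ) (ω : Ω) : armWeight A Y i (fun y => ENNReal.ofReal (Real.exp (f y))) t ω =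
      ENNReal.ofReal (Real.exp (∑ s ∈ Finset.Icc 1 t with A s ω = i, f (Y s ω))) := by
  rw [Real.exp_sum, ENNReal.ofReal_prod_of_nonneg fun _ _ => Real.exp_nonneg _, armWeight]

theorem IsBanditInteraction.measurable_armWeight (hA : IsBanditInteraction P ν ℱ A Y) (i : Fin K)
    {g : ℝ → ℝ≥0∞} (hg : Measurable g) (t : ℕ) : Measurable[ℱ t] (armWeight A Y i g t) := by
  induction t with
  | zero => exact measurable_const
  | succ t ih =>
    simp_rw [funext (armWeight_succ A Y i g t)]
    exact (ih.mono (ℱ.mono t.le_succ) le_rfl).mul <| Measurable.ite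
      (hA.measurable_arm t (measurableSet_singleton i)) (hg.comp (hA.measurable_reward t))
      measurable_const

theorem IsBanditInteraction.lintegral_armWeight_succ (hA : IsBanditInteraction P ν ℱ A Y)
    (i : Fin K) {g : ℝ → ℝ≥0∞} (hg : Measurable g) (t : ℕ) :
    ∫⁻ ω, armWeight A Y i g (t + 1) ω ∂P =
      (∫⁻ y, g y ∂(ν i)) * ∫⁻ ω in A (t + 1) ⁻¹' {i}, armWeight A Y i g t ω ∂P +
        ∫⁻ ω in (A (t + 1) ⁻¹' {i})ᶜ, armWeight A Y i g t ω ∂P := by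
  have hE := hA.measurableSet_arm t i
  rw [← lintegral_add_compl _ hE,
    ← hA.setLIntegral_mul_reward t i (hA.measurable_armWeight i hg t) hg]
  congr 1
  · refine setLIntegral_congr_fun hE fun ω (hω : A (t + 1) ω = i) => ?_
    rw [armWeight_succ, if_pos hω]
  · refine setLIntegral_congr_fun hE.compl fun ω (hω : A (t + 1) ω ≠ i) => ?_
    rw [armWeight_succ, if_neg hω, mul_one]

theorem maxGap_nonneg (μ : Fin K → ℝ) (k : Fin K) : 0 ≤ maxGap μ k :=
  (sub_self (μ k)).ge.trans (Finset.le_sup' (fun i => μ k - μ i) (Finset.mem_univ k))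

theorem IsBanditInteraction.expectedRegret_le [IsFiniteMeasure P]
    (hA : IsBanditInteraction P ν ℱ A Y) (μ : Fin K → ℝ) (k : Fin K) (T : ℕ) :
    expectedRegret P μ k A T ≤
      maxGap μ k * ∑ t ∈ Finset.range T, P.real (A (t + 1) ⁻¹' {k})ᶜ := by
  have hmeas (t : ℕ) : Measurable (A (t + 1)) := (hA.measurable_arm t).mono (ℱ.le _) le_rfl
  have hint (t : ℕ) : Integrable (fun ω => μ k - μ (A (t + 1) ω)) P :=
    (Integrable.of_finite (μ := P.map (A (t + 1))) (f := fun i => μ k - μ i)).comp_measurable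
      (hmeas t)
  simp_rw [expectedRegret, ← Finset.Ico_add_one_right_eq_Icc, Finset.sum_Ico_eq_sum_range,
    Nat.add_sub_cancel, add_comm 1]
  rw [integral_finsetSum _ fun t _ => hint t, Finset.mul_sum]
  refine Finset.sum_le_sum fun t _ => ?_
  have hE : MeasurableSet (A (t + 1) ⁻¹' {k})ᶜ := (hA.measurableSet_arm t k).compl
  calc ∫ ω, (μ k - μ (A (t + 1) ω)) ∂P
      ≤ ∫ ω, (A (t + 1) ⁻¹' {k})ᶜ.indicator (fun _ => maxGap μ k) ω ∂P := by
        refine integral_mono (hint t) ((integrable_const _).indicator hE) fun ω => ?_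
        by_cases hω : A (t + 1) ω = k
        · have hnotMem : ω ∉ (A (t + 1) ⁻¹' {k})ᶜ := fun h => h hω
          rw [Set.indicator_of_notMem hnotMem, hω, sub_self]
        · have hmem : ω ∈ (A (t + 1) ⁻¹' {k})ᶜ := hω
          rw [Set.indicator_of_mem hmem]
          exact Finset.le_sup' (fun i => μ k - μ i) (Finset.mem_univ (A (t + 1) ω))
    _ = maxGap μ k * P.real (A (t + 1) ⁻¹' {k})ᶜ := by
        rw [integral_indicator_const _ hE, smul_eq_mul, mul_comm]

end Interaction

/-- The decay rate, per unit of total exploration, of the probability that the empirical mean of an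
arm with `c`-sub-Gaussian rewards is off by `δ`, when an exploration step plays each of `K` arms
with probability `1 / K`. Each observation of the arm contributes a factor
`exp (-δ ^ 2 / (2 * c))` to the Chernoff bound. The value at `c = 0` is `0`, since `x / 0 = 0`. -/
noncomputable def deviationRate (K : ℕ) (c : ℝ≥0) (δ : ℝ) : ℝ :=
  (1 - Real.exp (-δ ^ 2 / (2 * c))) / K

theorem deviationRate_pos {K : ℕ} (hK : 0 < K) {c : ℝ≥0} (hc : 0 < c) {δ : ℝ} (hδ : 0 < δ) :
    0 < deviationRate K c δ :=
  div_pos (sub_pos.mpr (Real.exp_lt_one_iff.mpr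
    (div_neg_of_neg_of_pos (neg_neg_of_pos (pow_pos hδ 2)) (by positivity))))
    (Nat.cast_pos.mpr hK)

section EpsGreedy

variable {K d n₀ : ℕ} {Ω : Type*} {mΩ : MeasurableSpace Ω} {P : Measure Ω}
  {ν : Fin K → Measure ℝ} {ℱ : Filtration ℕ mΩ} {A : ℕ → Ω → Fin K} {Y : ℕ → Ω → ℝ}
  {Φ : Matrix (Fin K) (Fin d) ℝ} {ε : ℕ → ℝ} {θ : ℕ → Ω → Fin d → ℝ} {G : ℕ → Ω → Fin K}
  {μ : Fin K → ℝ} {k : Fin K} {δ : ℝ}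

theorem IsEpsGreedy.greedy_eq (h : IsEpsGreedy P Φ ε n₀ ℱ A Y θ G) (hΦ : Φ.rank = d)
    (hμ : cell μ δ ⊆ robustObservationRegion Φ k) {t : ℕ} (ht : n₀ ≤ t) {ω : Ω}
    (hdev : ∀ i, |∑ s ∈ Finset.Icc 1 t with A s ω = i, (Y s ω - μ i)| <
      δ * ((Finset.Icc 1 t).filter (A · ω = i)).card) : G (t + 1) ω = k := by
  have hθ := mem_robustParameterRegion_of_leastSquares hΦ hμ (h.leastSquares t ht ω) hdev
  by_contra hne
  exact (hθ _ hne).not_ge (h.greedy t ht ω k)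

theorem IsEpsGreedy.exploration_mul_lintegral_le [IsFiniteMeasure P]
    (h : IsEpsGreedy P Φ ε n₀ ℱ A Y θ G) {t : ℕ} (ht : n₀ ≤ t)
    (hε : ε (t + 1) ∈ Set.Icc (0 : ℝ) 1) (i : Fin K) {W : Ω → ℝ≥0∞} (hW : Measurable[ℱ t] W) :
    ENNReal.ofReal (ε (t + 1) / K) * ∫⁻ ω, W ω ∂P ≤ ∫⁻ ω in A (t + 1) ⁻¹' {i}, W ω ∂P := by
  rw [← smul_eq_mul, ← lintegral_smul_measure]
  refine lintegral_mono_of_forall_measurableSet_le (ℱ.le t) (fun S hS => ?_) hW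
  rw [Measure.smul_apply, Measure.restrict_apply (ℱ.le t _ hS), smul_eq_mul,
    ← ofReal_measureReal (μ := P) (s := S), ← ENNReal.ofReal_mul (div_nonneg hε.1 K.cast_nonneg),
    ← ofReal_measureReal (μ := P) (s := S ∩ A (t + 1) ⁻¹' {i}), h.arm_law t ht S hS i]
  refine ENNReal.ofReal_le_ofReal ?_
  rw [div_mul_eq_mul_div, ← mul_div_assoc]
  exact le_add_of_nonneg_left (mul_nonneg (sub_nonneg.mpr hε.2) measureReal_nonneg)

theorem IsEpsGreedy.lintegral_armWeight_succ_le [IsFiniteMeasure P]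
    (hA : IsBanditInteraction P ν ℱ A Y) (h : IsEpsGreedy P Φ ε n₀ ℱ A Y θ G)
    {t : ℕ} (ht : n₀ ≤ t) (hε : ε (t + 1) ∈ Set.Icc (0 : ℝ) 1) (i : Fin K) {g : ℝ → ℝ≥0∞}
    (hg : Measurable g) {η : ℝ} (hη : η ∈ Set.Icc (0 : ℝ) 1)
    (hgη : ∫⁻ y, g y ∂(ν i) ≤ ENNReal.ofReal (1 - η))
    (hfin : ∫⁻ ω, armWeight A Y i g t ω ∂P ≠ ∞) :
    ∫⁻ ω, armWeight A Y i g (t + 1) ω ∂P ≤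
      ENNReal.ofReal (Real.exp (-(η * (ε (t + 1) / K)))) * ∫⁻ ω, armWeight A Y i g t ω ∂P := by
  have hexplore := h.exploration_mul_lintegral_le ht hε i (hA.measurable_armWeight i hg t)
  have hsplit := lintegral_add_compl (μ := P) (armWeight A Y i g t) (hA.measurableSet_arm t i)
  rw [← hsplit] at hfin hexplore
  rw [hA.lintegral_armWeight_succ i hg, ← hsplit]
  exact mul_add_le_ofReal_exp_neg_mul hfin hη.1 hη.2 (div_nonneg hε.1 K.cast_nonneg) hexplore hgη

theorem IsBanditInteraction.lintegral_armWeight_succ_le_self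
    (hA : IsBanditInteraction P ν ℱ A Y) (i : Fin K) {g : ℝ → ℝ≥0∞} (hg : Measurable g)
    (hg1 : ∫⁻ y, g y ∂(ν i) ≤ 1) (t : ℕ) :
    ∫⁻ ω, armWeight A Y i g (t + 1) ω ∂P ≤ ∫⁻ ω, armWeight A Y i g t ω ∂P := by
  rw [hA.lintegral_armWeight_succ i hg,
    ← lintegral_add_compl (μ := P) (armWeight A Y i g t) (hA.measurableSet_arm t i)]
  exact add_le_add_left (mul_le_of_le_one_left' hg1) _

theorem IsEpsGreedy.lintegral_armWeight_le [IsProbabilityMeasure P]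
    (hA : IsBanditInteraction P ν ℱ A Y) (h : IsEpsGreedy P Φ ε n₀ ℱ A Y θ G)
    (hε : ∀ t, ε t ∈ Set.Icc (0 : ℝ) 1) (i : Fin K) {g : ℝ → ℝ≥0∞} (hg : Measurable g) {η : ℝ}
    (hη : η ∈ Set.Icc (0 : ℝ) 1) (hgη : ∫⁻ y, g y ∂(ν i) ≤ ENNReal.ofReal (1 - η)) (t : ℕ) :
    ∫⁻ ω, armWeight A Y i g t ω ∂P ≤
      ENNReal.ofReal (Real.exp (-(η / K * ∑ s ∈ Finset.Ico n₀ t, ε (s + 1)))) := by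
  induction t with
  | zero => simp [armWeight]
  | succ t ih =>
    rcases lt_or_ge t n₀ with hlt | hge
    · rw [Finset.Ico_eq_empty_of_le hlt.le] at ih
      rw [Finset.Ico_eq_empty_of_le hlt]
      have hg1 := hgη.trans (ENNReal.ofReal_le_one.mpr (sub_le_self 1 hη.1))
      exact (hA.lintegral_armWeight_succ_le_self i hg hg1 t).trans ih
    · have hfin := ne_top_of_le_ne_top ENNReal.ofReal_ne_top ih
      calc _ ≤ _ := h.lintegral_armWeight_succ_le hA hge (hε _) i hg hη hgη hfin
        _ ≤ _ := mul_le_mul_right ih _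
        _ = _ := by
          rw [← ENNReal.ofReal_mul (Real.exp_nonneg _), ← Real.exp_add,
            Finset.sum_Ico_succ_top hge]
          ring_nf

theorem IsEpsGreedy.measureReal_le_sum_reward_le [IsProbabilityMeasure P]
    (hA : IsBanditInteraction P ν ℱ A Y) (h : IsEpsGreedy P Φ ε n₀ ℱ A Y θ G)
    (hε : ∀ t, ε t ∈ Set.Icc (0 : ℝ) 1) (i : Fin K) {f : ℝ → ℝ} (hf : Measurable f) {c : ℝ≥0}
    (hsub : HasSubgaussianMGF f c (ν i)) (hδ : 0 ≤ δ) (t : ℕ) :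
    P.real {ω | δ * ((Finset.Icc 1 t).filter (A · ω = i)).card ≤
        ∑ s ∈ Finset.Icc 1 t with A s ω = i, f (Y s ω)} ≤
      Real.exp (-(deviationRate K c δ * ∑ s ∈ Finset.Ico n₀ t, ε (s + 1))) := by
  -- `l = δ / c` minimizes the exponent `c * l ^ 2 / 2 - l * δ` of the Chernoff bound.
  set l : ℝ := δ / c
  set g : ℝ → ℝ≥0∞ := fun y => ENNReal.ofReal (Real.exp (l * f y - l * δ))
  have hg : Measurable g := by fun_prop
  have hexponent : c * l ^ 2 / 2 - l * δ = -δ ^ 2 / (2 * c) := by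
    rcases eq_or_ne c 0 with hc | hc
    · simp [l, hc]
    · simp only [l]
      field_simp
      ring
  have hmoment : ∫⁻ y, g y ∂(ν i) ≤ ENNReal.ofReal (1 - (1 - Real.exp (-δ ^ 2 / (2 * c)))) := by
    rw [sub_sub_cancel, ← hexponent]
    exact lintegral_exp_le_of_hasSubgaussianMGF hsub l (l * δ)
  have hη : 1 - Real.exp (-δ ^ 2 / (2 * c)) ∈ Set.Icc (0 : ℝ) 1 :=
    ⟨sub_nonneg.mpr (Real.exp_le_one_iff.mpr
      (div_nonpos_of_nonpos_of_nonneg (neg_nonpos.mpr (sq_nonneg δ)) (by positivity))),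
      sub_le_self 1 (Real.exp_nonneg _)⟩
  have hE := h.lintegral_armWeight_le hA hε i hg hη hmoment t
  refine ENNReal.toReal_le_of_le_ofReal (Real.exp_nonneg _) (le_trans ?_ hE)
  have hmeas := (hA.measurable_armWeight i hg t).mono (ℱ.le t) le_rfl
  refine meas_le_lintegral₀ hmeas.aemeasurable fun ω hω => ?_
  rw [armWeight_ofReal_exp, ENNReal.one_le_ofReal, Real.one_le_exp_iff, Finset.sum_sub_distrib,
    ← Finset.mul_sum, Finset.sum_const, nsmul_eq_mul, mul_left_comm, ← mul_sub, mul_comm _ δ]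
  exact mul_nonneg (div_nonneg hδ c.2) (sub_nonneg.mpr hω)

theorem IsEpsGreedy.measureReal_le_abs_sum_reward_sub_le [IsProbabilityMeasure P] {c : ℝ≥0}
    (hA : IsBanditInteraction P ν ℱ A Y) (h : IsEpsGreedy P Φ ε n₀ ℱ A Y θ G)
    (hε : ∀ t, ε t ∈ Set.Icc (0 : ℝ) 1)
    (hν : ∀ i, HasSubgaussianMGF (fun y => y - μ i) c (ν i)) (hδ : 0 ≤ δ) (i : Fin K)
    (t : ℕ) :
    P.real {ω | δ * ((Finset.Icc 1 t).filter (A · ω = i)).card ≤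
        |∑ s ∈ Finset.Icc 1 t with A s ω = i, (Y s ω - μ i)|} ≤
      2 * Real.exp (-(deviationRate K c δ * ∑ s ∈ Finset.Ico n₀ t, ε (s + 1))) := by
  have hupper := h.measureReal_le_sum_reward_le hA hε i (by fun_prop) (hν i) hδ t
  have hlower := h.measureReal_le_sum_reward_le hA hε i (by fun_prop) (hν i).neg hδ t
  simp only [Pi.neg_apply, Finset.sum_neg_distrib] at hlower
  simp_rw [le_abs, Set.ofPred_or, two_mul]
  exact (measureReal_union_le _ _).trans (add_le_add hupper hlower)

theorem IsEpsGreedy.measureReal_greedy_ne_le [IsProbabilityMeasure P] {c : ℝ≥0}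
    (hA : IsBanditInteraction P ν ℱ A Y) (h : IsEpsGreedy P Φ ε n₀ ℱ A Y θ G)
    (hε : ∀ t, ε t ∈ Set.Icc (0 : ℝ) 1)
    (hν : ∀ i, HasSubgaussianMGF (fun y => y - μ i) c (ν i)) (hδ : 0 ≤ δ)
    (hΦ : Φ.rank = d) (hμ : cell μ δ ⊆ robustObservationRegion Φ k) {t : ℕ} (ht : n₀ ≤ t) :
    P.real (G (t + 1) ⁻¹' {k})ᶜ ≤
      2 * K * Real.exp (-(deviationRate K c δ * ∑ s ∈ Finset.Ico n₀ t, ε (s + 1))) := by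
  have hsub : (G (t + 1) ⁻¹' {k})ᶜ ⊆
      ⋃ i, {ω | δ * ((Finset.Icc 1 t).filter (A · ω = i)).card ≤
        |∑ s ∈ Finset.Icc 1 t with A s ω = i, (Y s ω - μ i)|} := fun ω hω => by
    by_contra hcon
    exact hω (h.greedy_eq hΦ hμ ht fun i =>
      lt_of_not_ge fun hi => hcon (Set.mem_iUnion_of_mem i hi))
  calc P.real (G (t + 1) ⁻¹' {k})ᶜ
      ≤ P.real _ := measureReal_mono hsub
    _ ≤ ∑ i, P.real _ := measureReal_iUnion_fintype_le _
    _ ≤ ∑ _i : Fin K, _ := Finset.sum_le_sum fun i _ =>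
        h.measureReal_le_abs_sum_reward_sub_le hA hε hν hδ i t
    _ = _ := by
        rw [Finset.sum_const, Finset.card_univ, Fintype.card_fin, nsmul_eq_mul]
        ring

theorem IsEpsGreedy.measureReal_arm_ne_le_add [IsProbabilityMeasure P]
    (hA : IsBanditInteraction P ν ℱ A Y) (h : IsEpsGreedy P Φ ε n₀ ℱ A Y θ G) {t : ℕ}
    (ht : n₀ ≤ t) (hε : 0 ≤ ε (t + 1)) (k : Fin K) :
    P.real (A (t + 1) ⁻¹' {k})ᶜ ≤ ε (t + 1) + P.real (G (t + 1) ⁻¹' {k})ᶜ := by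
  have hG : MeasurableSet (G (t + 1) ⁻¹' {k}) :=
    ℱ.le t _ (h.measurable_greedy t ht (measurableSet_singleton k))
  have hlaw := h.arm_law t ht Set.univ MeasurableSet.univ k
  simp only [Set.univ_inter, probReal_univ] at hlaw
  rw [probReal_compl_eq_one_sub (hA.measurableSet_arm t k), probReal_compl_eq_one_sub hG, hlaw]
  have hexplore : 0 ≤ ε (t + 1) * (1 / K) := by positivity
  have hexploit : ε (t + 1) * P.real (G (t + 1) ⁻¹' {k}) ≤ ε (t + 1) :=
    mul_le_of_le_one_right hε measureReal_le_one
  linarith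

theorem IsEpsGreedy.measureReal_arm_ne_le [IsProbabilityMeasure P] {c : ℝ≥0}
    (hA : IsBanditInteraction P ν ℱ A Y) (h : IsEpsGreedy P Φ ε n₀ ℱ A Y θ G)
    (hε : ∀ t, ε t ∈ Set.Icc (0 : ℝ) 1)
    (hν : ∀ i, HasSubgaussianMGF (fun y => y - μ i) c (ν i)) (hδ : 0 ≤ δ)
    (hΦ : Φ.rank = d) (hμ : cell μ δ ⊆ robustObservationRegion Φ k) (t : ℕ) :
    P.real (A (t + 1) ⁻¹' {k})ᶜ ≤ ε (t + 1) +
      2 * K * Real.exp (-(deviationRate K c δ * ∑ s ∈ Finset.Ico n₀ t, ε (s + 1))) := by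
  rcases lt_or_ge t n₀ with hlt | hge
  · have hK : (1 : ℝ) ≤ K := mod_cast k.pos
    rw [Finset.Ico_eq_empty_of_le hlt.le, Finset.sum_empty, mul_zero, neg_zero, Real.exp_zero]
    linarith [measureReal_le_one (μ := P) (s := (A (t + 1) ⁻¹' {k})ᶜ), (hε (t + 1)).1]
  · exact (h.measureReal_arm_ne_le_add hA hge (hε _).1 k).trans
      (by gcongr; exact h.measureReal_greedy_ne_le hA hε hν hδ hΦ hμ hge)

theorem IsEpsGreedy.expectedRegret_le [IsProbabilityMeasure P] {c : ℝ≥0}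
    (hA : IsBanditInteraction P ν ℱ A Y) (h : IsEpsGreedy P Φ ε n₀ ℱ A Y θ G)
    (hε : ∀ t, ε t ∈ Set.Icc (0 : ℝ) 1)
    (hν : ∀ i, HasSubgaussianMGF (fun y => y - μ i) c (ν i)) (hδ : 0 ≤ δ)
    (hΦ : Φ.rank = d) (hμ : cell μ δ ⊆ robustObservationRegion Φ k) (T : ℕ) :
    expectedRegret P μ k A T ≤ maxGap μ k * ∑ t ∈ Finset.range T, (ε (t + 1) +
      2 * K * Real.exp (-(deviationRate K c δ * ∑ s ∈ Finset.Ico n₀ t, ε (s + 1)))) :=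
  (hA.expectedRegret_le μ k T).trans <| mul_le_mul_of_nonneg_left
    (Finset.sum_le_sum fun t _ => h.measureReal_arm_ne_le hA hε hν hδ hΦ hμ t) (maxGap_nonneg μ k)

end EpsGreedy

section InvSqrt

theorem one_div_sqrt_mem_Icc (t : ℕ) : 1 / √(t : ℝ) ∈ Set.Icc (0 : ℝ) 1 := by
  rcases t.eq_zero_or_pos with rfl | ht
  · simp
  · exact ⟨by positivity, div_le_one_of_le₀ (Real.one_le_sqrt.mpr (mod_cast ht)) (by positivity)⟩

theorem one_div_sqrt_succ_le_two_mul_sub (t : ℕ) :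
    1 / √((t + 1 : ℕ) : ℝ) ≤ 2 * (√((t + 1 : ℕ) : ℝ) - √(t : ℝ)) := by
  have hb : 0 < √((t + 1 : ℕ) : ℝ) := by positivity
  have hab : √(t : ℝ) ^ 2 + 1 = √((t + 1 : ℕ) : ℝ) ^ 2 := by
    rw [Real.sq_sqrt t.cast_nonneg, Real.sq_sqrt (Nat.cast_nonneg _), Nat.cast_succ]
  rw [div_le_iff₀ hb]
  linarith [sq_nonneg (√((t + 1 : ℕ) : ℝ) - √(t : ℝ))]

theorem two_mul_sqrt_succ_sub_sqrt_le {t : ℕ} (ht : 0 < t) :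
    2 * (√((t + 1 : ℕ) : ℝ) - √(t : ℝ)) ≤ 1 / √(t : ℝ) := by
  have ha : 0 < √(t : ℝ) := by positivity
  have hab : √(t : ℝ) ^ 2 + 1 = √((t + 1 : ℕ) : ℝ) ^ 2 := by
    rw [Real.sq_sqrt t.cast_nonneg, Real.sq_sqrt (Nat.cast_nonneg _), Nat.cast_succ]
  rw [le_div_iff₀ ha]
  linarith [sq_nonneg (√((t + 1 : ℕ) : ℝ) - √(t : ℝ))]

theorem sum_range_one_div_sqrt_succ_le (T : ℕ) :
    ∑ t ∈ Finset.range T, 1 / √((t + 1 : ℕ) : ℝ) ≤ 2 * √(T : ℝ) := calc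
  _ ≤ ∑ t ∈ Finset.range T, 2 * (√((t + 1 : ℕ) : ℝ) - √(t : ℝ)) :=
    Finset.sum_le_sum fun t _ => one_div_sqrt_succ_le_two_mul_sub t
  _ = 2 * √(T : ℝ) := by
    rw [← Finset.mul_sum, Finset.sum_range_sub fun t : ℕ => √(t : ℝ), Nat.cast_zero,
      Real.sqrt_zero, sub_zero]

theorem two_mul_sqrt_sub_sqrt_le_sum_Ico (m n : ℕ) :
    2 * (√((n + 1 : ℕ) : ℝ) - √((m + 1 : ℕ) : ℝ)) ≤
      ∑ s ∈ Finset.Ico m n, 1 / √((s + 1 : ℕ) : ℝ) := by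
  rcases le_total n m with hnm | hmn
  · rw [Finset.Ico_eq_empty_of_le hnm, Finset.sum_empty]
    have : √((n + 1 : ℕ) : ℝ) ≤ √((m + 1 : ℕ) : ℝ) := by gcongr
    linarith
  · rw [← Finset.sum_Ico_sub (fun s : ℕ => √((s + 1 : ℕ) : ℝ)) hmn, Finset.mul_sum]
    exact Finset.sum_le_sum fun s _ => two_mul_sqrt_succ_sub_sqrt_le s.succ_pos

theorem exp_neg_mul_sum_Ico_one_div_sqrt_le {κ : ℝ} (hκ : 0 < κ) (m n : ℕ) :
    Real.exp (-(κ * ∑ s ∈ Finset.Ico m n, 1 / √((s + 1 : ℕ) : ℝ))) ≤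
      Real.exp (2 * κ * √((m + 1 : ℕ) : ℝ)) / (2 * κ) * (1 / √((n + 1 : ℕ) : ℝ)) := by
  have hsum := mul_le_mul_of_nonneg_left (two_mul_sqrt_sub_sqrt_le_sum_Ico m n) hκ.le
  calc _ ≤ Real.exp (2 * κ * √((m + 1 : ℕ) : ℝ) - 2 * κ * √((n + 1 : ℕ) : ℝ)) := by
        gcongr
        linarith
    _ = Real.exp (2 * κ * √((m + 1 : ℕ) : ℝ)) / Real.exp (2 * κ * √((n + 1 : ℕ) : ℝ)) :=
        Real.exp_sub _ _
    _ ≤ Real.exp (2 * κ * √((m + 1 : ℕ) : ℝ)) / (2 * κ * √((n + 1 : ℕ) : ℝ)) := by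
        gcongr
        linarith [Real.add_one_le_exp (2 * κ * √((n + 1 : ℕ) : ℝ))]
    _ = _ := by rw [div_mul_div_comm, mul_one]

theorem sum_range_one_div_sqrt_add_exp_le {κ : ℝ} (hκ : 0 < κ) {b : ℝ} (hb : 0 ≤ b) (m T : ℕ) :
    ∑ t ∈ Finset.range T, (1 / √((t + 1 : ℕ) : ℝ) +
        b * Real.exp (-(κ * ∑ s ∈ Finset.Ico m t, 1 / √((s + 1 : ℕ) : ℝ)))) ≤
      (1 + b * (Real.exp (2 * κ * √((m + 1 : ℕ) : ℝ)) / (2 * κ))) * (2 * √(T : ℝ)) := calc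
  _ ≤ ∑ t ∈ Finset.range T, (1 + b * (Real.exp (2 * κ * √((m + 1 : ℕ) : ℝ)) / (2 * κ))) *
        (1 / √((t + 1 : ℕ) : ℝ)) := by
    refine Finset.sum_le_sum fun t _ => ?_
    rw [one_add_mul, mul_assoc b]
    gcongr
    exact exp_neg_mul_sum_Ico_one_div_sqrt_le hκ m t
  _ ≤ _ := by
    rw [← Finset.mul_sum]
    gcongr
    exact sum_range_one_div_sqrt_succ_le T

end InvSqrt

theorem mainTheorem2_general (K n₀ : ℕ) (δ : ℝ) (hδ : 0 < δ) (σ : ℝ≥0) (hσ : 0 < σ) :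
    ∃ C : ℝ, ∀ (d : ℕ) (Φ : Matrix (Fin K) (Fin d) ℝ), Φ.rank = d →
      ∀ (k : Fin K) (μ : Fin K → ℝ), cell μ δ ⊆ robustObservationRegion Φ k →
      ∀ ν : Fin K → Measure ℝ, IsSubgaussianBandit ν μ σ →
      ∀ (Ω : Type*) (mΩ : MeasurableSpace Ω) (P : Measure Ω), IsProbabilityMeasure P →
      ∀ (ℱ : Filtration ℕ mΩ) (A : ℕ → Ω → Fin K) (Y : ℕ → Ω → ℝ)
        (θ : ℕ → Ω → Fin d → ℝ) (G : ℕ → Ω → Fin K),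
        IsBanditInteraction P ν ℱ A Y →
        IsEpsGreedy P Φ (fun t => 1 / √(t : ℝ)) n₀ ℱ A Y θ G →
        ∀ T : ℕ, expectedRegret P μ k A T ≤ C * (maxGap μ k * √(T : ℝ)) := by
  set κ := deviationRate K (σ ^ 2) δ
  refine ⟨2 * (1 + 2 * K * (Real.exp (2 * κ * √((n₀ + 1 : ℕ) : ℝ)) / (2 * κ))), ?_⟩
  intro d Φ hΦ k μ hμ ν hν Ω mΩ P _ ℱ A Y θ G hA hG T
  have hκ : 0 < κ := deviationRate_pos k.pos (pow_pos hσ 2) hδ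
  calc expectedRegret P μ k A T
      ≤ maxGap μ k * _ := hG.expectedRegret_le hA one_div_sqrt_mem_Icc hν.subgaussian hδ.le hΦ hμ T
    _ ≤ maxGap μ k * _ := mul_le_mul_of_nonneg_left
        (sum_range_one_div_sqrt_add_exp_le hκ (by positivity) n₀ T) (maxGap_nonneg μ k)
    _ = _ := by ring

/-- The constant `C` depends only on the number of arms `K`, on the size `δ` of a cell around the
mean vector inside the robust observation region, and on the length `n₀` of the initial phase. -/
theorem mainTheorem2 (K n₀ : ℕ) (δ : ℝ) (hδ : 0 < δ) :
    ∃ C : ℝ, ∀ (d : ℕ) (Φ : Matrix (Fin K) (Fin d) ℝ), d < K → Φ.rank = d →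
      ∀ (k : Fin K) (μ : Fin K → ℝ), cell μ δ ⊆ robustObservationRegion Φ k →
      ∀ ν : Fin K → Measure ℝ, IsSubgaussianBandit ν μ (1 / 2) →
      ∀ (Ω : Type*) (mΩ : MeasurableSpace Ω) (P : Measure Ω), IsProbabilityMeasure P →
      ∀ (ℱ : Filtration ℕ mΩ) (A : ℕ → Ω → Fin K) (Y : ℕ → Ω → ℝ)
        (θ : ℕ → Ω → Fin d → ℝ) (G : ℕ → Ω → Fin K),
        IsBanditInteraction P ν ℱ A Y →
        IsEpsGreedy P Φ (fun t => 1 / √(t : ℝ)) n₀ ℱ A Y θ G →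
        ∀ T : ℕ, expectedRegret P μ k A T ≤ C * (maxGap μ k * √(T : ℝ)) := by
  obtain ⟨C, hC⟩ := mainTheorem2_general K n₀ δ hδ (1 / 2) (by positivity)
  exact ⟨C, fun d Φ _ => hC d Φ⟩
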